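/- Let $n,m\in\mathbb N$. A complex-valued neural network with activation function $\varrho:\mathbb C\to\mathbb C$, input dimension $n$, output dimension $m$ and $W$ neurons per hidden layer is a map $V_L\circ\varrho^{\times W}\circ V_{L-1}\circ\cdots\circ\varrho^{\times W}\circ V_1:\mathbb C^n\to\mathbb C^m$, where $L\ge 2$ is arbitrary, $V_1:\mathbb C^n\to\mathbb C^W$, $V_2,\dots,V_{L-1}:\mathbb C^W\to\mathbb C^W$ and $V_L:\mathbb C^W\to\mathbb C^m$ are $\mathbb C$-affine, and $\varrho^{\times W}$ applies $\varrho$ to each component. Let $\mathcal{NN}^{\varrho}_{n,m,W}$ be the set of all these maps. A set $\mathcal F$ of functions $\mathbb C^n\to\mathbb C^m$ is called universal if for every continuous $g:\mathbb C^n\to\mathbb C^m$, every compact $K\subseteq\mathbb C^n$ and every $\varepsilon>0$ there is $f\in\mathcal F$ with $\|f(z)-g(z)\|<\varepsilon$ for all $z\in K$, where $\|\cdot\|$ is the Euclidean norm. Write $\partial\varrho=\frac12\left(\frac{\partial\varrho}{\partial x}-\mathrm i\frac{\partial\varrho}{\partial y}\right)$ and $\overline\partial\varrho=\frac12\left(\frac{\partial\varrho}{\partial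 x}+\mathrm i\frac{\partial\varrho}{\partial y}\right)$ for the Wirtinger derivatives. **Theorem.** Let $\varrho:\mathbb C\to\mathbb C$ be of class $C^2$ in the sense of real variables, and suppose that $\varrho$ is neither holomorphic on $\mathbb C$, nor antiholomorphic on $\mathbb C$ (i.e. $\overline{\varrho}$ is not holomorphic), nor $\mathbb R$-affine. Then $\mathcal{NN}^{\varrho}_{n,m,2n+2m+5}$ is universal. Moreover, if there is a point $z_0\in\mathbb C$ with either $\partial\varrho(z_0)\neq 0=\overline\partial\varrho(z_0)$ or $\partial\varrho(z_0)=0\neq\overline\partial\varrho(z_0)$, then $\mathcal{NN}^{\varrho}_{n,m,n+m+4}$ is universal. -/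

import Mathlib

open scoped ComplexConjugate

/-- The partial derivative of `ρ : ℂ → ℂ` in the direction of the real axis. -/
noncomputable def partialX (ρ : ℂ → ℂ) (z : ℂ) : ℂ :=
  deriv (fun t : ℝ => ρ (z + (t : ℂ))) 0

/-- The partial derivative of `ρ : ℂ → ℂ` in the direction of the imaginary axis. -/
noncomputable def partialY (ρ : ℂ → ℂ) (z : ℂ) : ℂ :=
  deriv (fun t : ℝ => ρ (z + Complex.I * (t : ℂ))) 0

/-- The Wirtinger derivative `∂ρ = (∂ρ/∂x - i ∂ρ/∂y) / 2`. -/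
noncomputable def wirt (ρ : ℂ → ℂ) (z : ℂ) : ℂ :=
  (1 / 2 : ℂ) * (partialX ρ z - Complex.I * partialY ρ z)

/-- The conjugate Wirtinger derivative `∂̄ρ = (∂ρ/∂x + i ∂ρ/∂y) / 2`. -/
noncomputable def wirtBar (ρ : ℂ → ℂ) (z : ℂ) : ℂ :=
  (1 / 2 : ℂ) * (partialX ρ z + Complex.I * partialY ρ z)

/-- `ρ` is holomorphic on all of `ℂ`. -/
def IsHolomorphic (ρ : ℂ → ℂ) : Prop := Differentiable ℂ ρ

/-- `ρ` is antiholomorphic: its pointwise complex conjugate is holomorphic. -/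
def IsAntiholomorphic (ρ : ℂ → ℂ) : Prop := IsHolomorphic (fun z => conj (ρ z))

/-- `ρ` is an affine map of the real vector space `ℂ`. -/
def IsRealAffine (ρ : ℂ → ℂ) : Prop := ∃ A : ℂ →ᵃ[ℝ] ℂ, ∀ z, ρ z = A z

/-- Componentwise application of the activation function. -/
noncomputable def activate (ρ : ℂ → ℂ) (W : ℕ) (z : EuclideanSpace ℂ (Fin W)) :
    EuclideanSpace ℂ (Fin W) :=
  WithLp.toLp 2 (fun j => ρ (z j))

/-- `HiddenPart ρ n W h` means that `h : ℂⁿ → ℂᵂ` is of the form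
`ρ^{×W} ∘ V_k ∘ ρ^{×W} ∘ ⋯ ∘ ρ^{×W} ∘ V₁` with some number `k ≥ 1` of hidden layers,
where `V₁ : ℂⁿ → ℂᵂ` and `V₂, …, V_k : ℂᵂ → ℂᵂ` are complex affine. -/
inductive HiddenPart (ρ : ℂ → ℂ) (n W : ℕ) :
    (EuclideanSpace ℂ (Fin n) → EuclideanSpace ℂ (Fin W)) → Prop
  | first (V : EuclideanSpace ℂ (Fin n) →ᵃ[ℂ] EuclideanSpace ℂ (Fin W)) :
      HiddenPart ρ n W (fun z => activate ρ W (V z))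
  | next (V : EuclideanSpace ℂ (Fin W) →ᵃ[ℂ] EuclideanSpace ℂ (Fin W))
      (h : EuclideanSpace ℂ (Fin n) → EuclideanSpace ℂ (Fin W)) (hh : HiddenPart ρ n W h) :
      HiddenPart ρ n W (fun z => activate ρ W (V (h z)))

/-- The complex-valued neural networks of arbitrary depth `L ≥ 2` with activation function `ρ`,
input dimension `n`, output dimension `m`, and `W` neurons in each hidden layer. -/
def NN (ρ : ℂ → ℂ) (n m W : ℕ) :
    Set (EuclideanSpace ℂ (Fin n) → EuclideanSpace ℂ (Fin m)) :=
  {f | ∃ (V : EuclideanSpace ℂ (Fin W) →ᵃ[ℂ] EuclideanSpace ℂ (Fin m))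
      (h : EuclideanSpace ℂ (Fin n) → EuclideanSpace ℂ (Fin W)),
      HiddenPart ρ n W h ∧ f = fun z => V (h z)}

/-- The universal approximation property of a class of functions `ℂⁿ → ℂᵐ`. -/
def IsUniversal {n m : ℕ}
    (F : Set (EuclideanSpace ℂ (Fin n) → EuclideanSpace ℂ (Fin m))) : Prop :=
  ∀ g : EuclideanSpace ℂ (Fin n) → EuclideanSpace ℂ (Fin m), Continuous g →
    ∀ K : Set (EuclideanSpace ℂ (Fin n)), IsCompact K →
      ∀ ε : ℝ, 0 < ε → ∃ f ∈ F, ∀ z ∈ K, ‖f z - g z‖ < ε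

/-!
Networks are treated as elements of `C(ℂⁿ, ℂᵐ)` with the compact-open topology, so universality says
that their closure is everything. The hidden state of a network is read as a list of registers: `n`
for the input and `m + 2` working registers.

*Carrying registers.* Difference quotients of `ρ` at `z₀` converge locally uniformly to
`w ↦ ∂ρ(z₀) w + ∂̄ρ(z₀) conj w`. If exactly one coefficient vanishes, one neuron per register passes
on the register or its conjugate, and two such layers pass on the register itself; if both are
nonzero, two neurons per register, fed with `w` and `I * w`, do so (`IsCarrier`). One further neuron
evaluates `ρ` exactly. So networks of width `(n + m + 2) + 1`, respectively `2 (n + m + 2) + 1`, can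
perform any move `r ↦ r + f (ℓ r + b) v` with `ℓ` a linear functional, where `f` is `ρ`, or
`ρ ∘ conj` if registers are carried through conjugation (`IsCarrier.containsShears_postNN`). Neither
`ρ` nor `ρ ∘ conj` is holomorphic or `ℝ`-affine.

*What the moves generate.* For fixed `v` and functionals `ℓ` with `ℓ v = 0`, the functions that can
be added along `v` form a closed subspace (`shearModule`). As `f` is not holomorphic, differentiation
produces `conj (ℓ r)`; as `f` is not `ℝ`-affine, some second derivative is nonzero, and second
difference quotients produce one of `w ^ 2`, `w * conj w`, `conj w ^ 2` with `w = ℓ r`. Polarization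
gives products of two registers, up to conjugations.

*Computing with occupied registers.* If `Φ` can be added to one register and `ψ` to another, then
so can the increment of `Φ` caused by adding `ψ`, and the second register is restored, whatever it
held (`sandwich_mem_shearModule`). With three working registers this shows that the functions of the
input that can be added to every working register are closed under conjugation and products
(`star_mem_inputModule`, `mul_mem_inputModule`). They contain constants and coordinates, so by
Stone–Weierstrass they are all continuous functions (`inputModule_eq_top`). No further registers
are needed, however complicated the target is. For `m ≥ 1` there are `m + 2 ≥ 3` working registers;
for `m = 0` there is nothing to approximate.
-/

/-! ### Locally uniform convergence and difference quotients -/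

/-- Membership in a closure for the compact-open topology, unfolded to uniform approximation on
compact sets. -/
theorem ContinuousMap.mem_closure_iff_forall_isCompact {X Y : Type*} [TopologicalSpace X]
    [SeminormedAddCommGroup Y] {S : Set C(X, Y)} {g : C(X, Y)} :
    g ∈ closure S ↔ ∀ K : Set X, IsCompact K → ∀ ε : ℝ, 0 < ε →
      ∃ f ∈ S, ∀ x ∈ K, ‖f x - g x‖ < ε := by
  have hb := nhds_basis_uniformity
    (Metric.uniformity_basis_dist (α := Y)).compactConvergenceUniformity (x := g)
  rw [mem_closure_iff_nhds_basis hb]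
  constructor
  · intro h K hK ε hε
    obtain ⟨f, hf, hfg⟩ := h (K, ε) ⟨hK, hε⟩
    exact ⟨f, hf, fun x hx => by simpa [dist_eq_norm] using hfg x hx⟩
  · rintro h ⟨K, ε⟩ ⟨hK, hε⟩
    obtain ⟨f, hf, hfg⟩ := h K hK ε hε
    exact ⟨f, hf, fun x hx => by simpa [dist_eq_norm] using hfg x hx⟩

/-- The difference quotients at `t₀` of a family `t ↦ F t` with jointly continuous derivative `F'`
extend to a continuous curve in `C(X, ℂ)` with value `F' t₀` at `0`. So they converge to `F' t₀`
locally uniformly. -/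
theorem exists_continuous_slope {X : Type*} [TopologicalSpace X] [FirstCountableTopology X]
    {F F' : ℝ → X → ℂ} (hF : ∀ t x, HasDerivAt (fun t => F t x) (F' t x) t)
    (hF' : Continuous fun p : ℝ × X => F' p.1 p.2) (t₀ : ℝ) :
    ∃ Γ : ℝ → C(X, ℂ), Continuous Γ ∧ (∀ x, Γ 0 x = F' t₀ x) ∧
      ∀ s, s ≠ 0 → ∀ x, Γ s x = (s : ℂ)⁻¹ * (F (t₀ + s) x - F t₀ x) := by
  have hc : Continuous fun p : ℝ × X => ∫ θ in (0 : ℝ)..1, F' (t₀ + p.1 * θ) p.2 := by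
    apply intervalIntegral.continuous_parametric_intervalIntegral_of_continuous'
    exact hF'.comp (by fun_prop : Continuous fun q : (ℝ × X) × ℝ => (t₀ + q.1.1 * q.2, q.1.2))
  refine ⟨ContinuousMap.curry ⟨_, hc⟩, ContinuousMap.continuous _, ?_, ?_⟩
  · intro x
    simp [ContinuousMap.curry_apply]
  · intro s hs x
    have hs' : (s : ℂ) ≠ 0 := by exact_mod_cast hs
    have key : ∫ θ in (0 : ℝ)..1, F' (t₀ + s * θ) x
        = (s : ℂ)⁻¹ * F (t₀ + s * 1) x - (s : ℂ)⁻¹ * F (t₀ + s * 0) x := by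
      apply intervalIntegral.integral_eq_sub_of_hasDerivAt
        (f := fun θ : ℝ => (s : ℂ)⁻¹ * F (t₀ + s * θ) x)
      · intro θ _
        have h1 : HasDerivAt (fun θ : ℝ => t₀ + s * θ) s θ := by
          simpa using ((hasDerivAt_id θ).const_mul s).const_add t₀
        have h2 := ((hF (t₀ + s * θ) x).scomp θ h1).const_mul ((s : ℂ)⁻¹)
        exact h2.congr_deriv (by rw [Complex.real_smul, inv_mul_cancel_left₀ hs'])
      · apply Continuous.intervalIntegrable
        exact hF'.comp (by fun_prop : Continuous fun θ : ℝ => (t₀ + s * θ, x))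
    simp only [ContinuousMap.curry_apply, ContinuousMap.coe_mk, key]
    simp [mul_sub]

/-- A closed set that contains a continuous curve away from `0` contains it at `0`. -/
theorem IsClosed.curve_zero_mem {Y : Type*} [TopologicalSpace Y] {S : Set Y} (hS : IsClosed S)
    {Γ : ℝ → Y} (hΓ : Continuous Γ) (h : ∀ s, s ≠ 0 → Γ s ∈ S) : Γ 0 ∈ S := by
  have h0 : (0 : ℝ) ∈ closure ({0}ᶜ : Set ℝ) := (dense_compl_singleton (0 : ℝ)) 0
  have := map_mem_closure hΓ h0 (t := S) (fun s hs => h s hs)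
  rwa [hS.closure_eq] at this

/-! ### Real derivatives in complex coordinates -/

theorem ContinuousLinearMap.apply_eq_add_conj (L : ℂ →L[ℝ] ℂ) (w : ℂ) :
    L w = (1 / 2 : ℂ) * (L 1 - Complex.I * L Complex.I) * w
      + (1 / 2 : ℂ) * (L 1 + Complex.I * L Complex.I) * conj w := by
  have h : L w = (w.re : ℂ) * L 1 + (w.im : ℂ) * L Complex.I := by
    conv_lhs => rw [show w = w.re • (1 : ℂ) + w.im • Complex.I by
      simp [Complex.re_add_im]]
    rw [map_add, map_smul, map_smul, Complex.real_smul, Complex.real_smul]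
  rw [h]
  conv_rhs => rw [← Complex.re_add_im w]
  simp only [map_add, map_mul, Complex.conj_ofReal, Complex.conj_I]
  linear_combination (w.im : ℂ) * L Complex.I * Complex.I_sq

theorem partialX_eq_fderiv {ρ : ℂ → ℂ} {z : ℂ} (h : DifferentiableAt ℝ ρ z) :
    partialX ρ z = fderiv ℝ ρ z 1 := by
  have h1 : HasDerivAt (fun t : ℝ => z + (t : ℂ)) 1 0 := by
    simpa using (Complex.ofRealCLM.hasDerivAt (x := (0 : ℝ))).const_add z
  have h2 : HasFDerivAt ρ (fderiv ℝ ρ z) (z + ((0 : ℝ) : ℂ)) := by simpa using h.hasFDerivAt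
  exact (h2.comp_hasDerivAt (0 : ℝ) h1).deriv

theorem partialY_eq_fderiv {ρ : ℂ → ℂ} {z : ℂ} (h : DifferentiableAt ℝ ρ z) :
    partialY ρ z = fderiv ℝ ρ z Complex.I := by
  have h1 : HasDerivAt (fun t : ℝ => z + Complex.I * (t : ℂ)) Complex.I 0 := by
    simpa using ((Complex.ofRealCLM.hasDerivAt (x := (0 : ℝ))).const_mul Complex.I).const_add z
  have h2 : HasFDerivAt ρ (fderiv ℝ ρ z) (z + Complex.I * ((0 : ℝ) : ℂ)) := by
    simpa using h.hasFDerivAt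
  exact (h2.comp_hasDerivAt (0 : ℝ) h1).deriv

/-- The real derivative in terms of the Wirtinger derivatives. -/
theorem fderiv_apply_eq_wirt {ρ : ℂ → ℂ} {z : ℂ} (h : DifferentiableAt ℝ ρ z) (w : ℂ) :
    fderiv ℝ ρ z w = wirt ρ z * w + wirtBar ρ z * conj w := by
  rw [ContinuousLinearMap.apply_eq_add_conj, wirt, wirtBar, partialX_eq_fderiv h,
    partialY_eq_fderiv h]

/-- The Cauchy–Riemann criterion. -/
theorem isHolomorphic_of_wirtBar_eq_zero {ρ : ℂ → ℂ} (h : Differentiable ℝ ρ)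
    (h0 : ∀ z, wirtBar ρ z = 0) : IsHolomorphic ρ := by
  intro z
  refine differentiableAt_complex_iff_differentiableAt_real.2 ⟨h z, ?_⟩
  simp only [fderiv_apply_eq_wirt (h z), h0 z, smul_eq_mul]
  simp [mul_comm]

/-- A twice continuously differentiable map with vanishing second derivative is affine. -/
theorem isRealAffine_of_fderiv_fderiv_eq_zero {ρ : ℂ → ℂ} (h : ContDiff ℝ 2 ρ)
    (h0 : ∀ z, fderiv ℝ (fderiv ℝ ρ) z = 0) : IsRealAffine ρ := by
  have hd : Differentiable ℝ ρ := h.differentiable (by norm_num)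
  have hd' : Differentiable ℝ (fderiv ℝ ρ) :=
    (h.fderiv_right (m := 1) (by norm_num)).differentiable (by norm_num)
  have hconst := is_const_of_fderiv_eq_zero hd' h0
  have hsub : ∀ z, ρ z - fderiv ℝ ρ 0 z = ρ 0 - fderiv ℝ ρ 0 0 := fun z => by
    refine is_const_of_fderiv_eq_zero (𝕜 := ℝ) (f := fun z => ρ z - fderiv ℝ ρ 0 z)
      (by fun_prop) (fun y => ?_) z 0
    rw [fderiv_fun_sub (hd y) (by fun_prop), ContinuousLinearMap.fderiv, hconst y 0, sub_self]
  refine ⟨(fderiv ℝ ρ 0 : ℂ →ₗ[ℝ] ℂ).toAffineMap + AffineMap.const ℝ ℂ (ρ 0), fun z => ?_⟩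
  have := hsub z
  simp only [map_zero, sub_zero] at this
  simp [← this]

/-- The quadratic form of a nonzero symmetric real bilinear form on `ℂ`, in the coordinates
`w, conj w`. -/
theorem exists_quadratic_coeffs (B : ℂ →L[ℝ] ℂ →L[ℝ] ℂ) (hsymm : ∀ v w, B v w = B w v)
    (hB : B ≠ 0) : ∃ α β γ : ℂ, (α ≠ 0 ∨ β ≠ 0 ∨ γ ≠ 0) ∧
      ∀ w, B w w = α * w ^ 2 + β * (w * conj w) + γ * conj w ^ 2 := by
  set a := B 1 1
  set b := B 1 Complex.I
  set d := B Complex.I Complex.I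
  have hB2 : ∀ v w, B v w = v.re * w.re * a + v.re * w.im * b
      + v.im * w.re * b + v.im * w.im * d := by
    intro v w
    have hre : ∀ u : ℂ, u = u.re • (1 : ℂ) + u.im • Complex.I := fun u => by
      simp [Complex.re_add_im]
    have h1 : B v = v.re • B 1 + v.im • B Complex.I := by
      conv_lhs => rw [hre v]
      rw [map_add, map_smul, map_smul]
    have h2 : ∀ u, B u w = w.re • B u 1 + w.im • B u Complex.I := fun u => by
      conv_lhs => rw [hre w]
      rw [map_add, map_smul, map_smul]
    rw [h1, add_apply, smul_apply, smul_apply, h2, h2, hsymm Complex.I 1]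
    simp only [Complex.real_smul]
    ring
  refine ⟨(a - d - 2 * Complex.I * b) / 4, (a + d) / 2, (a - d + 2 * Complex.I * b) / 4, ?_, ?_⟩
  · by_contra! h
    obtain ⟨h1, h2, h3⟩ := h
    have ha : a = 0 := by linear_combination h1 + h2 + h3
    have hd : d = 0 := by linear_combination -h1 + h2 - h3
    have hb : b = 0 := by
      linear_combination Complex.I * h1 - Complex.I * h3 + b * Complex.I_sq
    exact hB (ContinuousLinearMap.ext fun v => ContinuousLinearMap.ext fun w => by
      simp [hB2, ha, hb, hd])
  · intro w
    rw [hB2]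
    conv_rhs => rw [← Complex.re_add_im w]
    simp only [map_add, map_mul, Complex.conj_ofReal, Complex.conj_I]
    ring_nf
    simp only [Complex.I_sq]
    ring

/-! ### Functions of one variable generated by the activation -/

/-- A closed subspace of `C(ℂ, ℂ)` with all dilates and translates of `f` contains the first
derivatives of `f`, read as functions of the direction. -/
theorem fderiv_mem_of_dilates_mem {f : ℂ → ℂ} (hf : ContDiff ℝ 2 f) {M : Submodule ℂ C(ℂ, ℂ)}
    (hM : IsClosed (M : Set C(ℂ, ℂ)))
    (hfM : ∀ (a b : ℂ) (g : C(ℂ, ℂ)), (∀ w, g w = f (a * w + b)) → g ∈ M)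
    (z ω : ℂ) (t : ℝ) (g : C(ℂ, ℂ)) (hg : ∀ w, g w = fderiv ℝ f (z + t • (ω * w)) (ω * w)) :
    g ∈ M := by
  have hd : Differentiable ℝ f := hf.differentiable (by norm_num)
  have hfc := hf.continuous
  have hdc : Continuous (fderiv ℝ f) := hf.continuous_fderiv (by norm_num)
  obtain ⟨Γ, hΓ, h0, hs⟩ := exists_continuous_slope
    (F := fun (t : ℝ) (w : ℂ) => f (z + t • (ω * w)))
    (F' := fun t w => fderiv ℝ f (z + t • (ω * w)) (ω * w))
    (fun t w => by
      have h1 : HasDerivAt (fun t : ℝ => z + t • (ω * w)) (ω * w) t := by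
        simpa using ((hasDerivAt_id t).smul_const (ω * w)).const_add z
      exact (hd _).hasFDerivAt.comp_hasDerivAt t h1) (by fun_prop) t
  have : g = Γ 0 := by ext w; rw [h0, hg]
  rw [this]
  have hmem : ∀ t : ℝ, (⟨fun w => f (z + t • (ω * w)), by fun_prop⟩ : C(ℂ, ℂ)) ∈ M := fun t =>
    hfM (t * ω) z _ fun w => by
      simp only [ContinuousMap.coe_mk, Complex.real_smul]; ring_nf
  refine hM.curve_zero_mem hΓ fun s hs0 => ?_
  have : Γ s = (s : ℂ)⁻¹ • ((⟨fun w => f (z + (t + s) • (ω * w)), by fun_prop⟩ : C(ℂ, ℂ))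
      - ⟨fun w => f (z + t • (ω * w)), by fun_prop⟩) := by
    ext w; rw [hs s hs0]; simp
  rw [this]
  exact M.smul_mem _ (M.sub_mem (hmem _) (hmem _))

/-- The analogue of `fderiv_mem_of_dilates_mem` for the second derivative. -/
theorem fderiv_fderiv_mem_of_dilates_mem {f : ℂ → ℂ} (hf : ContDiff ℝ 2 f)
    {M : Submodule ℂ C(ℂ, ℂ)} (hM : IsClosed (M : Set C(ℂ, ℂ)))
    (hfM : ∀ (a b : ℂ) (g : C(ℂ, ℂ)), (∀ w, g w = f (a * w + b)) → g ∈ M)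
    (z ω : ℂ) (g : C(ℂ, ℂ)) (hg : ∀ w, g w = fderiv ℝ (fderiv ℝ f) z (ω * w) (ω * w)) :
    g ∈ M := by
  have hf' : ContDiff ℝ 1 (fderiv ℝ f) := hf.fderiv_right (by norm_num)
  have hd : Differentiable ℝ (fderiv ℝ f) := hf'.differentiable (by norm_num)
  have hfc := hf'.continuous
  have hdc : Continuous (fderiv ℝ (fderiv ℝ f)) := hf'.continuous_fderiv (by norm_num)
  obtain ⟨Γ, hΓ, h0, hs⟩ := exists_continuous_slope
    (F := fun (t : ℝ) (w : ℂ) => fderiv ℝ f (z + t • (ω * w)) (ω * w))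
    (F' := fun t w => fderiv ℝ (fderiv ℝ f) (z + t • (ω * w)) (ω * w) (ω * w))
    (fun t w => by
      have h1 : HasDerivAt (fun t : ℝ => z + t • (ω * w)) (ω * w) t := by
        simpa using ((hasDerivAt_id t).smul_const (ω * w)).const_add z
      have h2 := (hd _).hasFDerivAt.comp_hasDerivAt t h1
      simpa using h2.clm_apply (hasDerivAt_const t (ω * w))) (by fun_prop) 0
  have : g = Γ 0 := by ext w; rw [h0, hg]; simp
  rw [this]
  refine hM.curve_zero_mem hΓ fun s hs0 => ?_
  have : Γ s = (s : ℂ)⁻¹ •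
      ((⟨fun w => fderiv ℝ f (z + (0 + s) • (ω * w)) (ω * w), by fun_prop⟩ : C(ℂ, ℂ))
        - ⟨fun w => fderiv ℝ f (z + (0 : ℝ) • (ω * w)) (ω * w), by fun_prop⟩) := by
    ext w; rw [hs s hs0]; simp
  rw [this]
  exact M.smul_mem _ (M.sub_mem (fderiv_mem_of_dilates_mem hf hM hfM z ω (0 + s) _ fun _ => rfl)
    (fderiv_mem_of_dilates_mem hf hM hfM z ω 0 _ fun _ => rfl))

/-- Complex conjugation as a continuous map. -/
noncomputable def conjMap : C(ℂ, ℂ) := ⟨fun w => conj w, Complex.continuous_conj⟩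

theorem conjMap_mem_of_dilates_mem {f : ℂ → ℂ} (hf : ContDiff ℝ 2 f)
    (hhol : ¬ IsHolomorphic f) {M : Submodule ℂ C(ℂ, ℂ)} (hM : IsClosed (M : Set C(ℂ, ℂ)))
    (hfM : ∀ (a b : ℂ) (g : C(ℂ, ℂ)), (∀ w, g w = f (a * w + b)) → g ∈ M)
    (hid : ContinuousMap.id ℂ ∈ M) : conjMap ∈ M := by
  have hd : Differentiable ℝ f := hf.differentiable (by norm_num)
  obtain ⟨z, hz⟩ : ∃ z, wirtBar f z ≠ 0 := by
    by_contra! h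
    exact hhol (isHolomorphic_of_wirtBar_eq_zero hd h)
  have h1 : (⟨fun w => fderiv ℝ f z w, by fun_prop⟩ : C(ℂ, ℂ)) ∈ M :=
    fderiv_mem_of_dilates_mem hf hM hfM z 1 0 _ fun w => by simp
  have : conjMap = (wirtBar f z)⁻¹ • ((⟨fun w => fderiv ℝ f z w, by fun_prop⟩ : C(ℂ, ℂ))
      - wirt f z • ContinuousMap.id ℂ) := by
    ext w
    simp [conjMap, fderiv_apply_eq_wirt (hd z), hz]
  rw [this]
  exact M.smul_mem _ (M.sub_mem h1 (M.smul_mem _ hid))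

/-- A closed subspace of `C(ℂ, ℂ)` with all dilates and translates of a function `f` that is not
`ℝ`-affine contains one of the quadratic monomials `w ^ 2`, `w * conj w`, `conj w ^ 2`. -/
theorem exists_quadratic_mem_of_dilates_mem {f : ℂ → ℂ} (hf : ContDiff ℝ 2 f)
    (haff : ¬ IsRealAffine f) {M : Submodule ℂ C(ℂ, ℂ)} (hM : IsClosed (M : Set C(ℂ, ℂ)))
    (hfM : ∀ (a b : ℂ) (g : C(ℂ, ℂ)), (∀ w, g w = f (a * w + b)) → g ∈ M) :
    ContinuousMap.id ℂ * ContinuousMap.id ℂ ∈ M ∨ ContinuousMap.id ℂ * conjMap ∈ M ∨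
      conjMap * conjMap ∈ M := by
  obtain ⟨z, hz⟩ : ∃ z, fderiv ℝ (fderiv ℝ f) z ≠ 0 := by
    by_contra! h
    exact haff (isRealAffine_of_fderiv_fderiv_eq_zero hf h)
  obtain ⟨α, β, γ, hne, hQ⟩ := exists_quadratic_coeffs _
    (fun v w => (hf.contDiffAt.isSymmSndFDerivAt (by simp)) v w) hz
  have hmem : ∀ ω : ℂ, (α * ω ^ 2) • (ContinuousMap.id ℂ * ContinuousMap.id ℂ)
      + (β * (ω * conj ω)) • (ContinuousMap.id ℂ * conjMap)
      + (γ * conj ω ^ 2) • (conjMap * conjMap) ∈ M := fun ω =>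
    fderiv_fderiv_mem_of_dilates_mem hf hM hfM z ω _ fun w => by
      rw [hQ]; simp [conjMap]; ring
  -- The three monomials scale differently under `1`, `I` and `1 + I`.
  have h1 := hmem 1
  have h2 := hmem Complex.I
  have h3 := hmem (1 + Complex.I)
  have e3 : (1 + Complex.I) ^ 2 = 2 * Complex.I := by linear_combination Complex.I_sq
  have e3' : (1 + -Complex.I) ^ 2 = -2 * Complex.I := by linear_combination Complex.I_sq
  have e3'' : (1 + Complex.I) * (1 + -Complex.I) = 2 := by linear_combination -Complex.I_sq
  simp only [map_add, map_one, Complex.conj_I, e3, e3', e3''] at h1 h2 h3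
  rcases hne with hα | hβ | hγ
  · left
    have := M.smul_mem (1 / (4 * α)) (M.sub_mem (M.sub_mem h1 h2)
      (M.smul_mem Complex.I (M.sub_mem h3 (M.add_mem h1 h2))))
    convert this using 1
    ext w
    simp
    field_simp
    ring_nf
    simp only [Complex.I_sq]
    ring
  · right; left
    have := M.smul_mem (1 / (2 * β)) (M.add_mem h1 h2)
    convert this using 1
    ext w
    simp
    field_simp
    ring
  · right; right
    have := M.smul_mem (1 / (4 * γ)) (M.add_mem (M.sub_mem h1 h2)
      (M.smul_mem Complex.I (M.sub_mem h3 (M.add_mem h1 h2))))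
    convert this using 1
    ext w
    simp
    field_simp
    ring_nf
    simp only [Complex.I_sq]
    ring

/-! ### Shears -/

section Shear

variable {E : Type*} [NormedAddCommGroup E] [NormedSpace ℂ E]

/-- The map `r ↦ r + φ r • v`, which adds a scalar function to the component along `v`. -/
noncomputable def shear (v : E) (φ : C(E, ℂ)) : C(E, E) :=
  ⟨fun r => r + φ r • v, by fun_prop⟩

@[simp] theorem shear_apply (v : E) (φ : C(E, ℂ)) (r : E) : shear v φ r = r + φ r • v := rfl

theorem continuous_shear [LocallyCompactSpace E] (v : E) :
    Continuous (shear v : C(E, ℂ) → C(E, E)) := by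
  apply ContinuousMap.continuous_of_continuous_uncurry
  simp only [Function.uncurry_def, shear_apply]
  fun_prop

/-- A closed set of continuous self-maps of `E` that contains the identity and is stable under
composition. -/
structure IsClosedMonoid (G : Set C(E, E)) : Prop where
  isClosed : IsClosed G
  id_mem : ContinuousMap.id E ∈ G
  comp_mem : ∀ S ∈ G, ∀ T ∈ G, S.comp T ∈ G

/-- The functions that do not depend on the component along `v` and whose multiples can all be
added to this component by a map in `G`. Independence of the component makes the shears along `v`
commute and compose additively, so that these functions form a subspace. -/
def shearModule {G : Set C(E, E)} (hG : IsClosedMonoid G) (v : E) : Submodule ℂ C(E, ℂ) where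
  carrier := {φ | (∀ (r : E) (t : ℂ), φ (r + t • v) = φ r) ∧ ∀ c : ℂ, shear v (c • φ) ∈ G}
  add_mem' := by
    rintro φ ψ ⟨h1, h2⟩ ⟨h3, h4⟩
    refine ⟨fun r t => by simp [h1, h3], fun c => ?_⟩
    have : shear v (c • (φ + ψ)) = (shear v (c • φ)).comp (shear v (c • ψ)) := by
      ext r : 1
      simp [h1, mul_add, add_smul]
      abel
    rw [this]
    exact hG.comp_mem _ (h2 c) _ (h4 c)
  zero_mem' := by
    refine ⟨fun r t => rfl, fun c => ?_⟩
    have : shear v (c • (0 : C(E, ℂ))) = ContinuousMap.id E := by ext r : 1; simp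
    rw [this]
    exact hG.id_mem
  smul_mem' := by
    rintro a φ ⟨h1, h2⟩
    refine ⟨fun r t => by simp [h1], fun c => ?_⟩
    rw [smul_smul]
    exact h2 _

variable {G : Set C(E, E)} {hG : IsClosedMonoid G}

theorem mem_shearModule {v : E} {φ : C(E, ℂ)} : φ ∈ shearModule hG v ↔
    (∀ (r : E) (t : ℂ), φ (r + t • v) = φ r) ∧ ∀ c : ℂ, shear v (c • φ) ∈ G := Iff.rfl

theorem isClosed_shearModule [LocallyCompactSpace E] (v : E) :
    IsClosed (shearModule hG v : Set C(E, ℂ)) := by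
  have : (shearModule hG v : Set C(E, ℂ)) =
      (⋂ (r : E) (t : ℂ), {φ | φ (r + t • v) = φ r}) ∩ ⋂ c : ℂ, {φ | shear v (c • φ) ∈ G} := by
    ext φ
    simp [mem_shearModule]
  rw [this]
  refine IsClosed.inter (isClosed_iInter fun r => isClosed_iInter fun t => ?_)
    (isClosed_iInter fun c => ?_)
  · exact isClosed_eq (continuous_eval_const _) (continuous_eval_const _)
  · exact hG.isClosed.preimage ((continuous_shear v).comp (continuous_const_smul c))

/-- The commutator trick: subtract `Φ` along `v`, add `ψ` along `u`, add `Φ` along `v`, subtract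
`ψ` along `u`. The component along `u` is restored, whatever its content, and the change of `Φ`
under the intermediate move along `u` remains in the component along `v`. -/
theorem sandwich_mem_shearModule {v u : E} {Φ ψ Θ : C(E, ℂ)} (hΦ : Φ ∈ shearModule hG v)
    (hψ : ψ ∈ shearModule hG u) (hψv : ∀ (r : E) (t : ℂ), ψ (r + t • v) = ψ r)
    (hΘ : ∀ r, Θ r = Φ (r + ψ r • u) - Φ r) : Θ ∈ shearModule hG v := by
  obtain ⟨h1, h2⟩ := hΦ
  obtain ⟨h3, h4⟩ := hψ
  have swap : ∀ (r : E) (s t : ℂ), r + s • v + t • u = r + t • u + s • v := fun r s t => by abel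
  refine ⟨fun r t => by rw [hΘ, hΘ, hψv, swap, h1, h1], fun c => ?_⟩
  have : shear v (c • Θ) = (shear u ((-1 : ℂ) • ψ)).comp ((shear v (c • Φ)).comp
      ((shear u ((1 : ℂ) • ψ)).comp (shear v ((-c) • Φ)))) := by
    ext r : 1
    simp only [ContinuousMap.comp_apply, shear_apply, ContinuousMap.smul_apply, hΘ, hψv, h3, h1,
      smul_eq_mul, swap, one_mul]
    simp only [mul_sub, sub_smul, neg_mul, neg_smul, one_mul]
    abel
  rw [this]
  exact hG.comp_mem _ (h4 _) _ (hG.comp_mem _ (h2 _) _ (hG.comp_mem _ (h4 _) _ (h2 _)))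

/-- Precomposition with a continuous map, as a linear map. -/
noncomputable def precompLinear {X Y : Type*} [TopologicalSpace X] [TopologicalSpace Y]
    (p : C(X, Y)) : C(Y, ℂ) →ₗ[ℂ] C(X, ℂ) where
  toFun g := g.comp p
  map_add' _ _ := rfl
  map_smul' _ _ := rfl

theorem isClosed_comap_precompLinear {X Y : Type*} [TopologicalSpace X] [TopologicalSpace Y]
    (p : C(X, Y)) {M : Submodule ℂ C(X, ℂ)} (hM : IsClosed (M : Set C(X, ℂ))) :
    IsClosed ((M.comap (precompLinear p) : Submodule ℂ C(Y, ℂ)) : Set C(Y, ℂ)) :=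
  hM.preimage (ContinuousMap.continuous_precomp p)

/-- `G` contains the shears that add `f` of an affine functional, or the affine functional itself,
along an arbitrary vector. -/
def ContainsShears (G : Set C(E, E)) (f : ℂ → ℂ) : Prop :=
  ∀ (v : E) (ℓ : E →L[ℂ] ℂ) (b : ℂ) (φ : C(E, ℂ)),
    ((∀ r, φ r = f (ℓ r + b)) ∨ ∀ r, φ r = ℓ r + b) → shear v φ ∈ G

variable {f : ℂ → ℂ}

theorem ContainsShears.affine_mem_shearModule (hGf : ContainsShears G f) {v : E}
    {ℓ : E →L[ℂ] ℂ} (hℓ : ℓ v = 0) (b : ℂ) (φ : C(E, ℂ)) (hφ : ∀ r, φ r = ℓ r + b) :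
    φ ∈ shearModule hG v :=
  ⟨fun r t => by simp [hφ, hℓ], fun c => hGf v (c • ℓ) (c * b) _ (Or.inr fun r => by
    simp [hφ, mul_add])⟩

/-- Dilates and translates of `f`, applied to a linear functional that vanishes at `v`, can be
added along `v`. The lemmas on closed subspaces of `C(ℂ, ℂ)` therefore apply to this comap. -/
theorem ContainsShears.dilates_mem_comap (hGf : ContainsShears G f) {v : E}
    {ℓ : E →L[ℂ] ℂ} (hℓ : ℓ v = 0) (a b : ℂ) (g : C(ℂ, ℂ)) (hg : ∀ w, g w = f (a * w + b)) :
    g ∈ (shearModule hG v).comap (precompLinear ⟨ℓ, ℓ.continuous⟩) := by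
  refine ⟨fun r t => by simp [precompLinear, hℓ], fun c => ?_⟩
  have : shear v (c • precompLinear ⟨ℓ, ℓ.continuous⟩ g) =
      shear (c • v) (precompLinear ⟨ℓ, ℓ.continuous⟩ g) := by
    ext r : 1; simp [smul_smul, mul_comm]
  rw [this]
  exact hGf (c • v) (a • ℓ) b _ (Or.inl fun r => by simp [precompLinear, hg])

/-- Conjugates of linear functionals can be added along `v`. -/
theorem ContainsShears.conj_mem_shearModule [LocallyCompactSpace E] (hGf : ContainsShears G f)
    (hf : ContDiff ℝ 2 f) (hhol : ¬ IsHolomorphic f) {v : E}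
    {ℓ : E →L[ℂ] ℂ} (hℓ : ℓ v = 0) (φ : C(E, ℂ)) (hφ : ∀ r, φ r = conj (ℓ r)) :
    φ ∈ shearModule hG v := by
  have h := conjMap_mem_of_dilates_mem hf hhol
    (isClosed_comap_precompLinear ⟨ℓ, ℓ.continuous⟩ (isClosed_shearModule (hG := hG) v))
    (hGf.dilates_mem_comap hℓ) (hGf.affine_mem_shearModule (hG := hG) hℓ 0 _ fun r => by
      simp [precompLinear])
  convert Submodule.mem_comap.1 h using 1
  ext r
  simp [hφ, precompLinear, conjMap]

/-- Polarization of the available quadratic monomial: a product of two linear functionals, each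
possibly conjugated, can be added along every `v` at which both vanish. -/
theorem ContainsShears.exists_mul_mem_shearModule [LocallyCompactSpace E]
    (hGf : ContainsShears G f) (hf : ContDiff ℝ 2 f) (haff : ¬ IsRealAffine f) (v : E) :
    ∃ σ τ : ℂ →+* ℂ, (σ = RingHom.id ℂ ∨ σ = starRingEnd ℂ) ∧
      (τ = RingHom.id ℂ ∨ τ = starRingEnd ℂ) ∧
      ∀ ℓ₁ ℓ₂ : E →L[ℂ] ℂ, ℓ₁ v = 0 → ℓ₂ v = 0 → ∀ φ : C(E, ℂ),
        (∀ r, φ r = σ (ℓ₁ r) * τ (ℓ₂ r)) → φ ∈ shearModule hG v := by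
  -- The intersection over all functionals makes the choice of the monomial independent of them.
  set M : Submodule ℂ C(ℂ, ℂ) := ⨅ ℓ : {ℓ : E →L[ℂ] ℂ // ℓ v = 0},
    (shearModule hG v).comap (precompLinear ⟨ℓ.1, ℓ.1.continuous⟩) with hMdef
  have hM : IsClosed (M : Set C(ℂ, ℂ)) := by
    rw [hMdef, Submodule.coe_iInf]
    exact isClosed_iInter fun ℓ => isClosed_comap_precompLinear _ (isClosed_shearModule v)
  have hMq : ∀ q ∈ M, ∀ ℓ : E →L[ℂ] ℂ, ℓ v = 0 →
      precompLinear ⟨ℓ, ℓ.continuous⟩ q ∈ shearModule hG v := fun q hq ℓ hℓ =>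
    (Submodule.mem_iInf _).1 hq ⟨ℓ, hℓ⟩
  rcases exists_quadratic_mem_of_dilates_mem hf haff hM (fun a b g hg =>
    (Submodule.mem_iInf _).2 fun ℓ => hGf.dilates_mem_comap ℓ.2 a b g hg) with h | h | h
  · refine ⟨RingHom.id ℂ, RingHom.id ℂ, Or.inl rfl, Or.inl rfl, fun ℓ₁ ℓ₂ h₁ h₂ φ hφ => ?_⟩
    have := (shearModule hG v).smul_mem (1 / 2) (Submodule.sub_mem _ (Submodule.sub_mem _
      (hMq _ h (ℓ₁ + ℓ₂) (by simp [h₁, h₂])) (hMq _ h ℓ₁ h₁)) (hMq _ h ℓ₂ h₂))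
    convert this using 1
    ext r
    simp [hφ, precompLinear]
    ring
  · refine ⟨RingHom.id ℂ, starRingEnd ℂ, Or.inl rfl, Or.inr rfl, fun ℓ₁ ℓ₂ h₁ h₂ φ hφ => ?_⟩
    have := (shearModule hG v).smul_mem (1 / 4) (Submodule.add_mem _
      (Submodule.sub_mem _ (hMq _ h (ℓ₁ + ℓ₂) (by simp [h₁, h₂]))
        (hMq _ h (ℓ₁ - ℓ₂) (by simp [h₁, h₂])))
      (Submodule.smul_mem _ Complex.I
        (Submodule.sub_mem _ (hMq _ h (ℓ₁ + Complex.I • ℓ₂) (by simp [h₁, h₂]))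
          (hMq _ h (ℓ₁ - Complex.I • ℓ₂) (by simp [h₁, h₂])))))
    convert this using 1
    ext r
    simp [hφ, precompLinear, conjMap]
    ring_nf
    simp only [Complex.I_sq]
    ring
  · refine ⟨starRingEnd ℂ, starRingEnd ℂ, Or.inr rfl, Or.inr rfl, fun ℓ₁ ℓ₂ h₁ h₂ φ hφ => ?_⟩
    have := (shearModule hG v).smul_mem (1 / 2) (Submodule.sub_mem _ (Submodule.sub_mem _
      (hMq _ h (ℓ₁ + ℓ₂) (by simp [h₁, h₂])) (hMq _ h ℓ₁ h₁)) (hMq _ h ℓ₂ h₂))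
    convert this using 1
    ext r
    simp [hφ, precompLinear, conjMap]
    ring

end Shear

/-! ### The functions of the input that can be added to a register -/

/-- The Stone–Weierstrass theorem for locally uniform approximation. -/
theorem StarSubalgebra.closure_eq_univ_of_separatesPoints {X : Type*} [TopologicalSpace X]
    (A : StarSubalgebra ℂ C(X, ℂ)) (hA : A.SeparatesPoints) :
    closure (A : Set C(X, ℂ)) = Set.univ := by
  refine Set.eq_univ_of_forall fun g => ContinuousMap.mem_closure_iff_forall_isCompact.2 ?_
  intro K hK ε hε
  have : CompactSpace K := isCompact_iff_compactSpace.1 hK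
  let ι : C(K, X) := ⟨Subtype.val, continuous_subtype_val⟩
  let B := A.map (ContinuousMap.compStarAlgHom' ℂ ℂ ι)
  have hB : B.SeparatesPoints := by
    intro x y hxy
    obtain ⟨_, ⟨f, hf, rfl⟩, hfxy⟩ := hA (fun h => hxy (Subtype.ext h) : (x : X) ≠ y)
    exact ⟨_, ⟨f.comp ι, ⟨f, hf, rfl⟩, rfl⟩, hfxy⟩
  have hmem : g.comp ι ∈ closure (B : Set C(K, ℂ)) := by
    rw [← StarSubalgebra.topologicalClosure_coe,
      ContinuousMap.starSubalgebra_topologicalClosure_eq_top_of_separatesPoints B hB]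
    trivial
  obtain ⟨_, ⟨f, hf, rfl⟩, hfg⟩ :=
    ContinuousMap.mem_closure_iff_forall_isCompact.1 hmem Set.univ isCompact_univ ε hε
  exact ⟨f, hf, fun x hx => hfg ⟨x, hx⟩ trivial⟩

section Register

variable {n k : ℕ}

/-- The first `n` registers, which hold the input. -/
noncomputable def inputPart (n k : ℕ) :
    C(EuclideanSpace ℂ (Fin (n + k)), EuclideanSpace ℂ (Fin n)) :=
  ⟨fun r => WithLp.toLp 2 fun j => r (Fin.castAdd k j), by fun_prop⟩

@[simp] theorem inputPart_apply (r : EuclideanSpace ℂ (Fin (n + k))) (j : Fin n) :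
    inputPart n k r j = r (Fin.castAdd k j) := rfl

/-- The unit vector of the `i`-th of the `k` working registers, which follow the input. -/
noncomputable def workVec (n : ℕ) {k : ℕ} (i : Fin k) : EuclideanSpace ℂ (Fin (n + k)) :=
  EuclideanSpace.single (Fin.natAdd n i) 1

@[simp] theorem workVec_castAdd (i : Fin k) (j : Fin n) : workVec n i (Fin.castAdd k j) = 0 := by
  simp only [workVec, PiLp.single_apply]
  rw [if_neg]
  simp [Fin.ext_iff]
  omega

@[simp] theorem workVec_natAdd (i j : Fin k) :
    workVec n i (Fin.natAdd n j) = if j = i then 1 else 0 := by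
  simp [workVec]

@[simp] theorem inputPart_add_smul_workVec (r : EuclideanSpace ℂ (Fin (n + k))) (t : ℂ)
    (i : Fin k) : inputPart n k (r + t • workVec n i) = inputPart n k r := by
  ext j
  simp

/-- The coordinate functional of a register. -/
noncomputable def coord {N : ℕ} (j : Fin N) : EuclideanSpace ℂ (Fin N) →L[ℂ] ℂ :=
  EuclideanSpace.proj j

@[simp] theorem coord_apply {N : ℕ} (j : Fin N) (r : EuclideanSpace ℂ (Fin N)) :
    coord j r = r j := rfl

variable {G : Set C(EuclideanSpace ℂ (Fin (n + k)), EuclideanSpace ℂ (Fin (n + k)))}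

/-- The functions of the input that can be added to every working register. -/
noncomputable def inputModule (hG : IsClosedMonoid G) :
    Submodule ℂ C(EuclideanSpace ℂ (Fin n), ℂ) :=
  ⨅ i : Fin k, (shearModule hG (workVec n i)).comap (precompLinear (inputPart n k))

variable {hG : IsClosedMonoid G} {f : ℂ → ℂ}

theorem mem_inputModule {φ : C(EuclideanSpace ℂ (Fin n), ℂ)} :
    φ ∈ inputModule hG ↔ ∀ i : Fin k, φ.comp (inputPart n k) ∈ shearModule hG (workVec n i) :=
  Submodule.mem_iInf _

theorem isClosed_inputModule :
    IsClosed (inputModule hG : Set C(EuclideanSpace ℂ (Fin n), ℂ)) := by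
  rw [inputModule, Submodule.coe_iInf]
  exact isClosed_iInter fun i => isClosed_comap_precompLinear _ (isClosed_shearModule _)

theorem star_mem_inputModule (hk : 2 < k) (hGf : ContainsShears G f) (hf : ContDiff ℝ 2 f)
    (hhol : ¬ IsHolomorphic f) {φ : C(EuclideanSpace ℂ (Fin n), ℂ)} (hφ : φ ∈ inputModule hG) :
    star φ ∈ inputModule hG := by
  rw [mem_inputModule] at hφ ⊢
  intro i
  obtain ⟨j, hji, -⟩ := Fin.exists_ne_and_ne_of_two_lt i i hk
  have hconj : (⟨fun r => conj (r (Fin.natAdd n j)), by fun_prop⟩ :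
      C(EuclideanSpace ℂ (Fin (n + k)), ℂ)) ∈ shearModule hG (workVec n i) :=
    hGf.conj_mem_shearModule hf hhol (ℓ := coord (Fin.natAdd n j)) (by simp [hji]) _ fun r => rfl
  exact sandwich_mem_shearModule hconj (hφ j) (fun r t => by simp) fun r => by simp

theorem mul_mem_inputModule (hk : 2 < k) (hGf : ContainsShears G f) (hf : ContDiff ℝ 2 f)
    (hhol : ¬ IsHolomorphic f) (haff : ¬ IsRealAffine f)
    {φ ψ : C(EuclideanSpace ℂ (Fin n), ℂ)} (hφ : φ ∈ inputModule hG) (hψ : ψ ∈ inputModule hG) :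
    φ * ψ ∈ inputModule hG := by
  rw [mem_inputModule]
  intro i
  obtain ⟨j, hji, -⟩ := Fin.exists_ne_and_ne_of_two_lt i i hk
  obtain ⟨l, hli, hlj⟩ := Fin.exists_ne_and_ne_of_two_lt i j hk
  obtain ⟨σ, τ, hσ, hτ, h⟩ :=
    hGf.exists_mul_mem_shearModule (hG := hG) hf haff (workVec n i)
  -- Conjugation of the factors undoes the conjugations in the available product.
  have hfix : ∀ σ : ℂ →+* ℂ, (σ = RingHom.id ℂ ∨ σ = starRingEnd ℂ) →
      ∀ φ ∈ inputModule hG, ∃ φ' ∈ inputModule hG, ∀ x, σ (φ' x) = φ x := by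
    rintro σ (rfl | rfl) φ hφ
    · exact ⟨φ, hφ, fun x => rfl⟩
    · exact ⟨star φ, star_mem_inputModule hk hGf hf hhol hφ, fun x => by simp⟩
  have hcont : ∀ σ : ℂ →+* ℂ, (σ = RingHom.id ℂ ∨ σ = starRingEnd ℂ) → Continuous σ := by
    rintro σ (rfl | rfl)
    · exact continuous_id
    · exact Complex.continuous_conj
  have hσc := hcont σ hσ
  have hτc := hcont τ hτ
  obtain ⟨φ', hφ', hσφ⟩ := hfix σ hσ φ hφ
  obtain ⟨ψ', hψ', hτψ⟩ := hfix τ hτ ψ hψ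
  rw [mem_inputModule] at hφ' hψ'
  have h0 : (⟨fun r => σ (r (Fin.natAdd n j)) * τ (r (Fin.natAdd n l)), by fun_prop⟩ :
      C(EuclideanSpace ℂ (Fin (n + k)), ℂ)) ∈ shearModule hG (workVec n i) :=
    h (coord (Fin.natAdd n j)) (coord (Fin.natAdd n l)) (by simp [hji]) (by simp [hli]) _
      fun r => rfl
  have h1 : (⟨fun r => φ (inputPart n k r) * τ (r (Fin.natAdd n l)), by fun_prop⟩ :
      C(EuclideanSpace ℂ (Fin (n + k)), ℂ)) ∈ shearModule hG (workVec n i) :=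
    sandwich_mem_shearModule h0 (hφ' j) (fun r t => by simp) fun r => by
      simp [hσφ, hlj]; ring
  exact sandwich_mem_shearModule h1 (hψ' l) (fun r t => by simp) fun r => by
    simp [hτψ]; ring

/-- With three working registers, every continuous function of the input can be added to a working
register: these functions form a closed star subalgebra that contains the coordinates. -/
theorem inputModule_eq_top (hk : 2 < k) (hGf : ContainsShears G f) (hf : ContDiff ℝ 2 f)
    (hhol : ¬ IsHolomorphic f) (haff : ¬ IsRealAffine f) : inputModule hG = ⊤ := by
  let A : StarSubalgebra ℂ C(EuclideanSpace ℂ (Fin n), ℂ) :=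
    { carrier := inputModule hG
      mul_mem' := mul_mem_inputModule hk hGf hf hhol haff
      add_mem' := (inputModule hG).add_mem
      algebraMap_mem' := fun c => mem_inputModule.2 fun i =>
        hGf.affine_mem_shearModule (ℓ := 0) rfl c _ fun r => by simp
      star_mem' := star_mem_inputModule hk hGf hf hhol }
  have hsep : A.SeparatesPoints := by
    intro x y hxy
    obtain ⟨j, hj⟩ : ∃ j, x j ≠ y j := by
      by_contra! h
      exact hxy (PiLp.ext h)
    refine ⟨_, ⟨⟨coord j, (coord j).continuous⟩, mem_inputModule.2 fun i => ?_, rfl⟩, hj⟩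
    exact hGf.affine_mem_shearModule (ℓ := coord (Fin.castAdd k j)) (by simp) 0 _
      fun r => by simp
  have := A.closure_eq_univ_of_separatesPoints hsep
  rw [show (A : Set C(EuclideanSpace ℂ (Fin n), ℂ)) = inputModule hG from rfl,
    isClosed_inputModule.closure_eq] at this
  exact SetLike.coe_injective this

end Register

/-! ### Networks up to locally uniform limits -/

section Network

variable {ρ : ℂ → ℂ} {n N M W : ℕ}

/-- The continuous maps that networks of width `W` approximate locally uniformly. -/
def approxNN (ρ : ℂ → ℂ) (n m W : ℕ) : Set C(EuclideanSpace ℂ (Fin n), EuclideanSpace ℂ (Fin m)) :=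
  closure {f | ⇑f ∈ NN ρ n m W}

/-- The continuous maps of the form `V₃ ∘ ρ^{×W} ∘ V₂` with affine `V₂` and `V₃`. -/
def oneLayer (ρ : ℂ → ℂ) (N M W : ℕ) : Set C(EuclideanSpace ℂ (Fin N), EuclideanSpace ℂ (Fin M)) :=
  {T | ∃ (V₂ : EuclideanSpace ℂ (Fin N) →ᵃ[ℂ] EuclideanSpace ℂ (Fin W))
    (V₃ : EuclideanSpace ℂ (Fin W) →ᵃ[ℂ] EuclideanSpace ℂ (Fin M)),
    ∀ r, T r = V₃ (activate ρ W (V₂ r))}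

theorem oneLayer_subset_NN {f : C(EuclideanSpace ℂ (Fin N), EuclideanSpace ℂ (Fin M))}
    (hf : f ∈ oneLayer ρ N M W) : ⇑f ∈ NN ρ N M W := by
  obtain ⟨V₂, V₃, h⟩ := hf
  exact ⟨V₃, _, HiddenPart.first V₂, funext h⟩

theorem closure_oneLayer_subset : closure (oneLayer ρ N M W) ⊆ approxNN ρ N M W :=
  closure_mono fun _ => oneLayer_subset_NN

/-- The affine output map of a network merges with the affine input map of a further layer. -/
theorem comp_mem_approxNN {T : C(EuclideanSpace ℂ (Fin N), EuclideanSpace ℂ (Fin M))}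
    {h : C(EuclideanSpace ℂ (Fin n), EuclideanSpace ℂ (Fin N))}
    (hT : T ∈ closure (oneLayer ρ N M W)) (hh : h ∈ approxNN ρ n N W) :
    T.comp h ∈ approxNN ρ n M W := by
  have hc : Continuous fun p : C(EuclideanSpace ℂ (Fin N), EuclideanSpace ℂ (Fin M)) ×
      C(EuclideanSpace ℂ (Fin n), EuclideanSpace ℂ (Fin N)) => p.1.comp p.2 :=
    ContinuousMap.continuous_comp'.comp continuous_swap
  refine map_mem_closure₂ hc hT hh ?_
  rintro T ⟨V₂, V₃, hT⟩ h ⟨V, H, hH, hh⟩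
  refine ⟨V₃, _, HiddenPart.next (V₂.comp V) H hH, ?_⟩
  ext x : 1
  simp [hT, hh]

theorem affine_comp_mem_approxNN {T : C(EuclideanSpace ℂ (Fin N), EuclideanSpace ℂ (Fin M))}
    {h : C(EuclideanSpace ℂ (Fin n), EuclideanSpace ℂ (Fin N))}
    (A : EuclideanSpace ℂ (Fin N) →L[ℂ] EuclideanSpace ℂ (Fin M))
    (v₀ : EuclideanSpace ℂ (Fin M)) (hT : ∀ r, T r = A r + v₀) (hh : h ∈ approxNN ρ n N W) :
    T.comp h ∈ approxNN ρ n M W := by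
  refine map_mem_closure (ContinuousMap.continuous_postcomp T) hh ?_
  rintro h ⟨V, H, hH, hh⟩
  refine ⟨((A : _ →ₗ[ℂ] _).toAffineMap + AffineMap.const ℂ _ v₀).comp V, H, hH, ?_⟩
  ext x : 1
  simp [hT, hh]

theorem isUniversal_of_approxNN_eq_univ (h : approxNN ρ n M W = Set.univ) :
    IsUniversal (NN ρ n M W) := by
  intro g hg K hK ε hε
  have hmem : (⟨g, hg⟩ : C(EuclideanSpace ℂ (Fin n), EuclideanSpace ℂ (Fin M))) ∈
      approxNN ρ n M W := h ▸ Set.mem_univ _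
  obtain ⟨f, hf, hfg⟩ := ContinuousMap.mem_closure_iff_forall_isCompact.1 hmem K hK ε hε
  exact ⟨f, hf, hfg⟩

/-- A layer of width `W` computes every combination of at most `W` neurons; the other neurons are
idle. -/
theorem mem_oneLayer_of_neurons {κ : Type*} [Fintype κ] (hκ : Fintype.card κ ≤ W)
    (ℓ : κ → EuclideanSpace ℂ (Fin N) →L[ℂ] ℂ) (b : κ → ℂ)
    (v : κ → EuclideanSpace ℂ (Fin M)) (v₀ : EuclideanSpace ℂ (Fin M))
    {T : C(EuclideanSpace ℂ (Fin N), EuclideanSpace ℂ (Fin M))}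
    (hT : ∀ r, T r = v₀ + ∑ i, ρ (ℓ i r + b i) • v i) : T ∈ oneLayer ρ N M W := by
  classical
  obtain ⟨e⟩ : Nonempty (κ ↪ Fin W) := Function.Embedding.nonempty_of_card_le (by simpa using hκ)
  refine ⟨((∑ i, (ℓ i).smulRight (EuclideanSpace.single (e i) (1 : ℂ)) :
      EuclideanSpace ℂ (Fin N) →L[ℂ] EuclideanSpace ℂ (Fin W)) : _ →ₗ[ℂ] _).toAffineMap
      + AffineMap.const ℂ _ (∑ i, b i • EuclideanSpace.single (e i) (1 : ℂ)),
    ((∑ i, (coord (e i)).smulRight (v i) :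
      EuclideanSpace ℂ (Fin W) →L[ℂ] EuclideanSpace ℂ (Fin M)) : _ →ₗ[ℂ] _).toAffineMap
      + AffineMap.const ℂ _ v₀, fun r => ?_⟩
  rw [hT]
  simp [activate, add_comm, Pi.single_apply]

/-- With `d` neurons per value, the map `σ` can be passed through a layer: it is a combination of
`d` dilates of the derivative of the activation at one point. For `σ` the identity or the
conjugation, this makes it possible to carry registers along. -/
def IsCarrier (ρ σ : ℂ → ℂ) (d : ℕ) : Prop :=
  ∃ (z₀ : ℂ) (ω c : Fin d → ℂ), ∀ w, ∑ t, c t * fderiv ℝ ρ z₀ (ω t * w) = σ w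

/-- One layer carries all registers through `σ`, and one more neuron evaluates the activation
exactly. -/
theorem IsCarrier.mem_closure_oneLayer {σ : ℂ → ℂ} {d : ℕ} (hσ : IsCarrier ρ σ d)
    (hρ : ContDiff ℝ 2 ρ) (hW : d * N + 1 ≤ W) (a : Fin N → EuclideanSpace ℂ (Fin M))
    (ℓ : EuclideanSpace ℂ (Fin N) →L[ℂ] ℂ) (b : ℂ) (v : EuclideanSpace ℂ (Fin M))
    {T : C(EuclideanSpace ℂ (Fin N), EuclideanSpace ℂ (Fin M))}
    (hT : ∀ r, T r = ∑ j, σ (r j) • a j + ρ (ℓ r + b) • v) :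
    T ∈ closure (oneLayer ρ N M W) := by
  obtain ⟨z₀, ω, c, hσ⟩ := hσ
  have hρc := hρ.continuous
  have hdc : Continuous (fderiv ℝ ρ) := hρ.continuous_fderiv (by norm_num)
  obtain ⟨Γ, hΓ, h0, hs⟩ := exists_continuous_slope (F := fun (t : ℝ) (w : ℂ) => ρ (z₀ + t • w))
    (F' := fun t w => fderiv ℝ ρ (z₀ + t • w) w)
    (fun t w => by
      have h1 : HasDerivAt (fun t : ℝ => z₀ + t • w) w t := by
        simpa using ((hasDerivAt_id t).smul_const w).const_add z₀
      exact (hρ.differentiable (by norm_num) _).hasFDerivAt.comp_hasDerivAt t h1)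
    (by fun_prop) 0
  have hΔ : Continuous fun p : ℝ × EuclideanSpace ℂ (Fin N) =>
      ∑ j, (∑ t, c t * Γ p.1 (ω t * p.2 j)) • a j + ρ (ℓ p.2 + b) • v := by
    fun_prop
  have key := (isClosed_closure (s := oneLayer ρ N M W)).curve_zero_mem
    (Γ := ContinuousMap.curry ⟨_, hΔ⟩) (ContinuousMap.continuous _) fun s hs0 => by
      apply subset_closure
      -- The constant cancels the values `ρ z₀` in the difference quotients.
      refine mem_oneLayer_of_neurons (κ := (Fin N × Fin d) ⊕ Unit) (by simpa [mul_comm] using hW)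
        (Sum.elim (fun p => ((s : ℂ) * ω p.2) • coord p.1) fun _ => ℓ)
        (Sum.elim (fun _ => z₀) fun _ => b)
        (Sum.elim (fun p => (c p.2 * (s : ℂ)⁻¹) • a p.1) fun _ => v)
        (-∑ j, ∑ t, (c t * (s : ℂ)⁻¹ * ρ z₀) • a j) fun r => ?_
      simp only [ContinuousMap.curry_apply, ContinuousMap.coe_mk, hs s hs0, Fintype.sum_sum_type,
        Fintype.sum_prod_type, Sum.elim_inl, Sum.elim_inr, Finset.univ_unique, Finset.sum_singleton]
      rw [← add_assoc, ← Finset.sum_neg_distrib, ← Finset.sum_add_distrib]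
      congr 1
      refine Finset.sum_congr rfl fun j _ => ?_
      rw [Finset.sum_smul, ← Finset.sum_neg_distrib, ← Finset.sum_add_distrib]
      refine Finset.sum_congr rfl fun t _ => ?_
      simp only [smul_smul, ← neg_smul, ← add_smul, smul_apply, coord_apply,
        Complex.real_smul, smul_eq_mul, zero_add, Complex.ofReal_zero, zero_mul, add_zero]
      congr 1
      rw [show z₀ + (s : ℂ) * (ω t * r j) = (s : ℂ) * ω t * r j + z₀ by ring]
      ring
  convert key using 1
  ext r : 1
  simp only [ContinuousMap.curry_apply, ContinuousMap.coe_mk, hT, h0, zero_smul, add_zero, hσ]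

theorem sum_smul_single (r : EuclideanSpace ℂ (Fin N)) :
    ∑ j, r j • EuclideanSpace.single j (1 : ℂ) = r := by
  ext i
  simp [Pi.single_apply]

variable {σ : ℂ →+* ℂ} {d : ℕ}

theorem IsCarrier.continuous (hσ : IsCarrier ρ σ d) : Continuous σ := by
  obtain ⟨z₀, ω, c, hσ⟩ := hσ
  rw [← funext hσ]
  fun_prop

/-- The componentwise application of `σ`. -/
noncomputable def mapReg (σ : ℂ → ℂ) (hσ : Continuous σ) (N : ℕ) :
    C(EuclideanSpace ℂ (Fin N), EuclideanSpace ℂ (Fin N)) :=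
  ⟨fun r => WithLp.toLp 2 fun j => σ (r j), by fun_prop⟩

theorem IsCarrier.mapReg_mem (hσ : IsCarrier ρ σ d) (hρ : ContDiff ℝ 2 ρ) (hW : d * N + 1 ≤ W) :
    mapReg σ hσ.continuous N ∈ closure (oneLayer ρ N N W) :=
  hσ.mem_closure_oneLayer hρ hW (fun j => EuclideanSpace.single j 1) 0 0 0 fun r => by
    ext i
    simp [mapReg, Pi.single_apply]

theorem IsCarrier.id_mem_approxNN (hσ : IsCarrier ρ σ d) (hσσ : ∀ w, σ (σ w) = w)
    (hρ : ContDiff ℝ 2 ρ) (hW : d * n + 1 ≤ W) : ContinuousMap.id _ ∈ approxNN ρ n n W := by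
  have := comp_mem_approxNN (hσ.mapReg_mem hρ hW) (closure_oneLayer_subset (hσ.mapReg_mem hρ hW))
  convert this using 1
  ext r i
  simp [mapReg, hσσ]

/-- Two layers: the first applies `σ` to all registers, the second applies it again and evaluates
the activation. -/
theorem IsCarrier.shear_comp_mem_approxNN (hσ : IsCarrier ρ σ d) (hσσ : ∀ w, σ (σ w) = w)
    (hρ : ContDiff ℝ 2 ρ) (hW : d * N + 1 ≤ W) (v : EuclideanSpace ℂ (Fin N))
    (ℓ : EuclideanSpace ℂ (Fin N) →L[ℂ] ℂ) (b : ℂ) (φ : C(EuclideanSpace ℂ (Fin N), ℂ))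
    (hφ : ∀ r, φ r = ρ (σ (ℓ r + b)))
    {h : C(EuclideanSpace ℂ (Fin n), EuclideanSpace ℂ (Fin N))} (hh : h ∈ approxNN ρ n N W) :
    (shear v φ).comp h ∈ approxNN ρ n N W := by
  have hσc := hσ.continuous
  have hρc := hρ.continuous
  let ℓ' : EuclideanSpace ℂ (Fin N) →L[ℂ] ℂ :=
    ∑ j, σ (ℓ (EuclideanSpace.single j 1)) • coord j
  have hℓ' : ∀ r, ℓ' (mapReg σ hσc N r) = σ (ℓ r) := fun r => by
    conv_rhs => rw [← sum_smul_single r]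
    simp [ℓ', mapReg, mul_comm]
  have h2 : (⟨fun r => (∑ j, σ (r j) • EuclideanSpace.single j (1 : ℂ)) + ρ (ℓ' r + σ b) • v,
      by fun_prop⟩ : C(EuclideanSpace ℂ (Fin N), EuclideanSpace ℂ (Fin N)))
        ∈ closure (oneLayer ρ N N W) :=
    hσ.mem_closure_oneLayer hρ hW _ ℓ' (σ b) v fun r => rfl
  have := comp_mem_approxNN h2 (comp_mem_approxNN (hσ.mapReg_mem hρ hW) hh)
  convert this using 1
  ext x : 1
  simp only [ContinuousMap.comp_apply, ContinuousMap.coe_mk, hℓ', shear_apply, hφ, map_add]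
  congr 1
  conv_lhs => rw [← sum_smul_single (h x)]
  simp [mapReg, hσσ]

/-- The maps that can be applied after every network, up to locally uniform limits. -/
def postNN (ρ : ℂ → ℂ) (n N W : ℕ) : Set C(EuclideanSpace ℂ (Fin N), EuclideanSpace ℂ (Fin N)) :=
  {T | ∀ h ∈ approxNN ρ n N W, T.comp h ∈ approxNN ρ n N W}

theorem isClosedMonoid_postNN : IsClosedMonoid (postNN ρ n N W) where
  isClosed := by
    simp only [postNN, Set.ofPred_forall]
    exact isClosed_iInter fun h => isClosed_iInter fun _ =>
      isClosed_closure.preimage (ContinuousMap.continuous_precomp h)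
  id_mem := fun h hh => by simpa using hh
  comp_mem := fun S hS T hT h hh => by
    rw [ContinuousMap.comp_assoc]
    exact hS _ (hT _ hh)

theorem IsCarrier.containsShears_postNN (hσ : IsCarrier ρ σ d) (hσσ : ∀ w, σ (σ w) = w)
    (hρ : ContDiff ℝ 2 ρ) (hW : d * N + 1 ≤ W) :
    ContainsShears (postNN ρ n N W) (fun w => ρ (σ w)) := by
  rintro v ℓ b φ (hφ | hφ) h hh
  · exact hσ.shear_comp_mem_approxNN hσσ hρ hW v ℓ b φ hφ hh
  · exact affine_comp_mem_approxNN (ContinuousLinearMap.id ℂ _ + ℓ.smulRight v) (b • v)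
      (fun r => by simp [hφ, add_smul, add_assoc]) hh

/-- Networks with `n + m + 2` carried registers and one free neuron are universal: load the input,
add the components of the target to `m` of the working registers, and read these off. -/
theorem IsCarrier.isUniversal {m : ℕ} (hσ : IsCarrier ρ σ d) (hσσ : ∀ w, σ (σ w) = w)
    (hρ : ContDiff ℝ 2 ρ) (hρσ : ContDiff ℝ 2 fun w => ρ (σ w))
    (hhol : ¬ IsHolomorphic fun w => ρ (σ w)) (haff : ¬ IsRealAffine fun w => ρ (σ w))
    (hm : 0 < m) (hW : d * (n + (m + 2)) + 1 ≤ W) : IsUniversal (NN ρ n m W) := by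
  refine isUniversal_of_approxNN_eq_univ (Set.eq_univ_of_forall fun g => ?_)
  have hGf := hσ.containsShears_postNN (n := n) hσσ hρ hW
  have htop := inputModule_eq_top (hG := isClosedMonoid_postNN) (by omega) hGf hρσ hhol haff
  have hadd : ∀ (i : Fin (m + 2)) (φ : C(EuclideanSpace ℂ (Fin n), ℂ)),
      shear (workVec n i) (φ.comp (inputPart n (m + 2))) ∈ postNN ρ n (n + (m + 2)) W := by
    intro i φ
    have hφ : φ ∈ inputModule (isClosedMonoid_postNN (ρ := ρ) (n := n) (N := n + (m + 2))
      (W := W)) := htop ▸ Submodule.mem_top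
    simpa using (mem_inputModule.1 hφ i).2 1
  let load : EuclideanSpace ℂ (Fin n) →L[ℂ] EuclideanSpace ℂ (Fin (n + (m + 2))) :=
    ∑ j, (coord j).smulRight (EuclideanSpace.single (Fin.castAdd (m + 2) j) 1)
  have hload : ∀ x, inputPart n (m + 2) (load x) = x := fun x => by
    ext j
    simp [load, Pi.single_apply]
  have hload' : ∀ x i, load x (Fin.natAdd n i) = 0 := fun x i => by
    have : ∀ j, Fin.natAdd n i ≠ Fin.castAdd (m + 2) j := fun j h => by
      have := congrArg Fin.val h
      simp at this
      omega
    simp [load, this]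
  have hinput : ∀ (s : Finset (Fin m)) (x : EuclideanSpace ℂ (Fin n)),
      inputPart n (m + 2) (load x + ∑ i ∈ s, g x i • workVec n (Fin.castAdd 2 i)) = x := by
    intro s x
    ext j
    simpa using congrArg (fun y => y j) (hload x)
  have hmem : ∀ s : Finset (Fin m),
      (⟨fun x => load x + ∑ i ∈ s, g x i • workVec n (Fin.castAdd 2 i), by fun_prop⟩ :
        C(EuclideanSpace ℂ (Fin n), EuclideanSpace ℂ (Fin (n + (m + 2)))))
        ∈ approxNN ρ n (n + (m + 2)) W := by
    intro s
    induction s using Finset.induction_on with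
    | empty =>
      have hn : d * n + 1 ≤ W := le_trans (by gcongr; omega) hW
      convert affine_comp_mem_approxNN (T := ⟨load, load.continuous⟩) load 0 (fun r => by simp)
        (hσ.id_mem_approxNN hσσ hρ hn) using 1
      ext x : 1
      simp
    | insert i s hi ih =>
      have := hadd (Fin.castAdd 2 i) ⟨fun x => g x i, by fun_prop⟩ _ ih
      convert this using 1
      ext x : 1
      simp only [ContinuousMap.comp_apply, ContinuousMap.coe_mk, shear_apply, hinput,
        Finset.sum_insert hi]
      abel
  let read : EuclideanSpace ℂ (Fin (n + (m + 2))) →L[ℂ] EuclideanSpace ℂ (Fin m) :=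
    ∑ i, (coord (Fin.natAdd n (Fin.castAdd 2 i))).smulRight (EuclideanSpace.single i 1)
  convert affine_comp_mem_approxNN (T := ⟨read, read.continuous⟩) read 0 (fun r => by simp)
    (hmem Finset.univ) using 1
  ext x i
  simp [read, hload', Pi.single_apply]

theorem isUniversal_of_output_zero : IsUniversal (NN ρ n 0 W) := fun g _ _ _ ε hε =>
  ⟨_, ⟨0, _, HiddenPart.first 0, rfl⟩, fun z _ => by
    rw [Subsingleton.elim (_ - g z) 0, norm_zero]
    exact hε⟩

end Network

/-! ### Carriers and the activation -/

theorem isCarrier_id_of_wirtBar_eq_zero {ρ : ℂ → ℂ} (hρ : Differentiable ℝ ρ) {z₀ : ℂ}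
    (h : wirt ρ z₀ ≠ 0) (h' : wirtBar ρ z₀ = 0) : IsCarrier ρ (RingHom.id ℂ) 1 :=
  ⟨z₀, fun _ => 1, fun _ => (wirt ρ z₀)⁻¹, fun w => by
    simp [fderiv_apply_eq_wirt (hρ z₀), h', h]⟩

theorem isCarrier_conj_of_wirt_eq_zero {ρ : ℂ → ℂ} (hρ : Differentiable ℝ ρ) {z₀ : ℂ}
    (h : wirt ρ z₀ = 0) (h' : wirtBar ρ z₀ ≠ 0) : IsCarrier ρ (starRingEnd ℂ) 1 :=
  ⟨z₀, fun _ => 1, fun _ => (wirtBar ρ z₀)⁻¹, fun w => by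
    simp [fderiv_apply_eq_wirt (hρ z₀), h', h]⟩

/-- The inputs `w` and `I * w` separate the complex linear part of the derivative from the
antilinear part. -/
theorem isCarrier_id_of_wirt_ne_zero {ρ : ℂ → ℂ} (hρ : Differentiable ℝ ρ) {z₀ : ℂ}
    (h : wirt ρ z₀ ≠ 0) : IsCarrier ρ (RingHom.id ℂ) 2 :=
  ⟨z₀, ![1, Complex.I], ![1 / (2 * wirt ρ z₀), -Complex.I / (2 * wirt ρ z₀)], fun w => by
    simp [fderiv_apply_eq_wirt (hρ z₀)]
    field_simp
    ring_nf
    simp only [Complex.I_sq]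
    ring⟩

theorem not_isHolomorphic_comp_conj {ρ : ℂ → ℂ} (h : ¬ IsAntiholomorphic ρ) :
    ¬ IsHolomorphic fun w => ρ (conj w) := by
  intro hh
  refine h fun z => ?_
  have := (hh (conj z)).conj_conj
  simpa [Function.comp_def] using this

theorem not_isRealAffine_comp_conj {ρ : ℂ → ℂ} (h : ¬ IsRealAffine ρ) :
    ¬ IsRealAffine fun w => ρ (conj w) := by
  rintro ⟨A, hA⟩
  refine h ⟨A.comp (Complex.conjCLE : ℂ →ₗ[ℝ] ℂ).toAffineMap, fun z => ?_⟩
  simpa using hA (conj z)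

/-- A point at which exactly one Wirtinger derivative vanishes carries each register with a single
neuron. -/
theorem isUniversal_of_one_neuron_carrier {n m W : ℕ} {ρ : ℂ → ℂ} (hC2 : ContDiff ℝ 2 ρ)
    (hhol : ¬ IsHolomorphic ρ) (hanti : ¬ IsAntiholomorphic ρ) (haff : ¬ IsRealAffine ρ)
    (hW : n + m + 3 ≤ W) {z₀ : ℂ}
    (h : (wirt ρ z₀ ≠ 0 ∧ wirtBar ρ z₀ = 0) ∨ (wirt ρ z₀ = 0 ∧ wirtBar ρ z₀ ≠ 0)) :
    IsUniversal (NN ρ n m W) := by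
  rcases m.eq_zero_or_pos with rfl | hm
  · exact isUniversal_of_output_zero
  have hd : Differentiable ℝ ρ := hC2.differentiable (by norm_num)
  rcases h with ⟨h, h'⟩ | ⟨h, h'⟩
  · exact (isCarrier_id_of_wirtBar_eq_zero hd h h').isUniversal (fun w => rfl) hC2 hC2 hhol haff hm
      (by omega)
  · exact (isCarrier_conj_of_wirt_eq_zero hd h h').isUniversal (fun w => by simp) hC2
      (hC2.comp Complex.conjCLE.contDiff) (not_isHolomorphic_comp_conj hanti)
      (not_isRealAffine_comp_conj haff) hm (by omega)

theorem mainTheorem3 (n m : ℕ) (ρ : ℂ → ℂ) (hC2 : ContDiff ℝ 2 ρ)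
    (hhol : ¬ IsHolomorphic ρ) (hanti : ¬ IsAntiholomorphic ρ) (haff : ¬ IsRealAffine ρ) :
    IsUniversal (NN ρ n m (2 * n + 2 * m + 5)) ∧
    ((∃ z₀ : ℂ, (wirt ρ z₀ ≠ 0 ∧ wirtBar ρ z₀ = 0) ∨ (wirt ρ z₀ = 0 ∧ wirtBar ρ z₀ ≠ 0)) →
      IsUniversal (NN ρ n m (n + m + 4))) := by
  refine ⟨?_, fun ⟨z₀, h⟩ =>
    isUniversal_of_one_neuron_carrier hC2 hhol hanti haff (by omega) h⟩
  rcases m.eq_zero_or_pos with rfl | hm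
  · exact isUniversal_of_output_zero
  have hd : Differentiable ℝ ρ := hC2.differentiable (by norm_num)
  obtain ⟨z₀, hz₀⟩ : ∃ z, wirtBar ρ z ≠ 0 := by
    by_contra! h
    exact hhol (isHolomorphic_of_wirtBar_eq_zero hd h)
  by_cases h : wirt ρ z₀ = 0
  · exact isUniversal_of_one_neuron_carrier hC2 hhol hanti haff (by omega) (Or.inr ⟨h, hz₀⟩)
  · exact (isCarrier_id_of_wirt_ne_zero hd h).isUniversal (fun w => rfl) hC2 hC2 hhol haff hm
      (by omega)
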